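/- **Online tree caching with bypassing.** Let $T$ be a finite rooted tree. For a node $v$ let $T(v)$ be the set of $v$ and all its descendants, and let $h(T)\ge 1$ be the height of $T$, i.e. the largest number of nodes on a path from the root to a node. A *subforest* of $T$ is a set $C$ of nodes such that $v\in C$ implies $T(v)\subseteq C$. Fix an integer $\alpha\ge 1$. An input $I$ is a finite sequence of requests, each consisting of a node and a sign (positive or negative). A solution with cache capacity $k$ starts with the empty cache; in each round it serves one request with its current cache $C$, paying $1$ if the request is positive and its node is not in $C$, or if it is negative and its node is in $C$, and $0$ otherwise. Right after the round it may change its cache to any subforest with at most $k$ nodes, paying $\alpha$ for each node fetched and each node evicted. $\mathrm{OPT}(I)$ is the minimum total cost of an (offline) solution with cache capacity $k_{\mathrm{OPT}}$. A non-empty set $X$ of nodes is a *valid positive changeset* for a cache $C$ if $X\cap C=\emptyset$ and $C\cup X$ is a subforest, a *valid negative changeset* if $X\subseteq C$ and $C\setminus X$ is a subforest, and a *valid changeset* if it is one of the two. The online algorithm TC with cache capacity $k_{\mathrm{ONL}}$ works in phases. It starts each phase with the empty cache and with a counter equal to zero at every node. Whenever it pays $1$ for a request, it increments the counter of the requested node.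 After each round it checks whether there is a valid changeset $X$ for its current cache such that the sum of the counters in $X$ is at least $|X|\cdot\alpha$, while for every valid changeset $Y\supsetneq X$ the sum of the counters in $Y$ is less than $|Y|\cdot\alpha$. If there is one, TC applies such an $X$: it fetches $X$ if $X$ is positive and evicts $X$ if $X$ is negative, and resets the counters of the nodes of $X$ to zero. However, if fetching $X$ would make the cache larger than $k_{\mathrm{ONL}}$, TC instead evicts all nodes from its cache and starts a new phase. Let $\mathrm{TC}(I)$ be the total cost of TC on $I$. **Theorem.** There is an absolute constant $c>0$ such that for every finite rooted tree $T$, all integers $\alpha\ge 1$, $k_{\mathrm{ONL}}\ge 1$ and $0\le k_{\mathrm{OPT}}\le k_{\mathrm{ONL}}$, and every input $I$, $$\mathrm{TC}(I)\;\le\; c\cdot h(T)\cdot\frac{k_{\mathrm{ONL}}}{k_{\mathrm{ONL}}-k_{\mathrm{OPT}}+1}\cdot \mathrm{OPT}(I)\;+\;c\cdot h(T)\cdot k_{\mathrm{ONL}}\cdot\alpha .$$ In particular, TC is $O\bigl(h(T)\cdot k_{\mathrm{ONL}}/(k_{\mathrm{ONL}}-k_{\mathrm{OPT}}+1)\bigr)$-competitive.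 -/

import Mathlib

/-! Online tree caching with bypassing.

The universe is a rooted tree `T`, given by Mathlib's `RootedTree`: `u ≤ v` means that `u` is an
ancestor of `v` (or `v` itself) and `⊥` is the root.  Hence `T(v) = Set.Ici v`, the path from `v`
to the root is `Set.Iic v`, and the subforests of `T` are exactly its upper sets. -/

universe u

namespace TreeCaching

/-- The height of a tree: the number of its levels, i.e. the largest number of nodes on a path
from the root to a node. A one-node tree has height one. -/
noncomputable def height (T : RootedTree.{u}) [Fintype T] : ℕ :=
  Finset.univ.sup fun v : T => (Set.Iic v).ncard

/-- A request: a node together with a sign. -/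
structure Request (V : Type u) where
  node : V
  positive : Bool

variable {T : RootedTree.{u}} [DecidableEq T]

/-- `C` is a subforest of `T`: if it contains `v`, it contains all of `T(v)`. -/
def IsSubforest (C : Finset T) : Prop :=
  ∀ v ∈ C, ∀ w : T, v ≤ w → w ∈ C

/-- The cost of serving a request with cache `C`: a positive request costs `1` if its node is not
cached, a negative request costs `1` if its node is cached; otherwise the request is free. -/
def serveCost (C : Finset T) (r : Request T) : ℕ :=
  if r.positive then (if r.node ∈ C then 0 else 1) else (if r.node ∈ C then 1 else 0)

/-- The cost of changing the cache contents from `C` to `D`: every fetched and every evicted node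
costs `α`. -/
def moveCost (α : ℕ) (C D : Finset T) : ℕ :=
  α * (symmDiff C D).card

/-- The total cost of the cache sequence `S` on the input `I 0, …, I (n - 1)`. Here `S t` is the
cache contents while request `I t` is served, and right afterwards the cache is changed
to `S (t + 1)`. -/
def cost (α : ℕ) (I : ℕ → Request T) (n : ℕ) (S : ℕ → Finset T) : ℕ :=
  ∑ t ∈ Finset.range n, (serveCost (S t) (I t) + moveCost α (S t) (S (t + 1)))

/-- `S` is a legal cache sequence for `n` requests and cache capacity `k`. -/
def IsFeasible (k n : ℕ) (S : ℕ → Finset T) : Prop :=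
  S 0 = ∅ ∧ ∀ t ≤ n, IsSubforest (S t) ∧ (S t).card ≤ k

/-- The cost of an optimal offline solution with cache capacity `k` for the input
`I 0, …, I (n - 1)`. -/
noncomputable def optCost (α k : ℕ) (I : ℕ → Request T) (n : ℕ) : ℕ :=
  sInf {c | ∃ S : ℕ → Finset T, IsFeasible k n S ∧ cost α I n S = c}

/-- The optimal offline cost is attained by a legal cache sequence. -/
theorem exists_cost_eq_optCost (α k : ℕ) (I : ℕ → Request T) (n : ℕ) :
    ∃ S : ℕ → Finset T, IsFeasible k n S ∧ cost α I n S = optCost α k I n := by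
  have h : {c | ∃ S : ℕ → Finset T, IsFeasible k n S ∧ cost α I n S = c}.Nonempty :=
    ⟨_, fun _ => ∅, ⟨rfl, fun t _ => by simp [IsSubforest]⟩, rfl⟩
  exact Nat.sInf_mem h

/-- `X` is a valid positive changeset for the cache `C`. -/
def IsPosChangeset (C X : Finset T) : Prop :=
  X.Nonempty ∧ Disjoint X C ∧ IsSubforest (C ∪ X)

/-- `X` is a valid negative changeset for the cache `C`. -/
def IsNegChangeset (C X : Finset T) : Prop :=
  X.Nonempty ∧ X ⊆ C ∧ IsSubforest (C \ X)

/-- `X` is a valid changeset for the cache `C`. -/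
def IsChangeset (C X : Finset T) : Prop :=
  IsPosChangeset C X ∨ IsNegChangeset C X

/-- With cache `C` and counters `cnt`, the set `X` is a valid changeset that has the saturation
property and the maximality property. -/
def IsApplicable (α : ℕ) (C : Finset T) (cnt : T → ℕ) (X : Finset T) : Prop :=
  IsChangeset C X ∧ X.card * α ≤ ∑ v ∈ X, cnt v ∧
    ∀ Y : Finset T, IsChangeset C Y → X ⊂ Y → ∑ v ∈ Y, cnt v < Y.card * α

/-- The state of the algorithm TC: its cache and the counters of all nodes. -/
structure TCState (T : RootedTree.{u}) where
  cache : Finset T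
  cnt : T → ℕ

/-- The state in which every phase of TC starts: empty cache and all counters zero. -/
def TCState.init : TCState T := ⟨∅, fun _ => 0⟩

/-- The counters after serving request `r`: the counter of the requested node grows by one if
TC pays for the request. -/
def countRequest (s : TCState T) (r : Request T) : T → ℕ :=
  fun v => if v = r.node then s.cnt v + serveCost s.cache r else s.cnt v

/-- TC applies the changeset `X` and resets the counters of its nodes. If fetching `X` would exceed
the cache capacity `k`, TC evicts all nodes instead and starts a new phase. -/
noncomputable def applyChangeset (k : ℕ) (C : Finset T) (cnt : T → ℕ) (X : Finset T) :
    TCState T := by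
  classical exact
    if IsPosChangeset C X then
      if (C ∪ X).card ≤ k then ⟨C ∪ X, fun v => if v ∈ X then 0 else cnt v⟩ else TCState.init
    else ⟨C \ X, fun v => if v ∈ X then 0 else cnt v⟩

/-- One round of TC with cache capacity `k`: serve the request `r`, update the counters, and apply
a valid changeset with the saturation and maximality properties if there is one. -/
noncomputable def tcStep (α k : ℕ) (s : TCState T) (r : Request T) : TCState T := by
  classical exact
    if h : ∃ X, IsApplicable α s.cache (countRequest s r) X then
      applyChangeset k s.cache (countRequest s r) h.choose
    else ⟨s.cache, countRequest s r⟩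

/-- The state of TC at time `t`, after serving the requests `I 0, …, I (t - 1)`. -/
noncomputable def tcState (α k : ℕ) (I : ℕ → Request T) : ℕ → TCState T
  | 0 => TCState.init
  | t + 1 => tcStep α k (tcState α k I t) (I t)

/-- The total cost of TC with cache capacity `k` on the input `I 0, …, I (n - 1)`. -/
noncomputable def tcCost (α k : ℕ) (I : ℕ → Request T) (n : ℕ) : ℕ :=
  cost α I n fun t => (tcState α k I t).cache

/-- TC produces legal cache sequences. -/
theorem tc_isFeasible (α k : ℕ) (I : ℕ → Request T) (n : ℕ) :
    IsFeasible k n fun t => (tcState α k I t).cache := by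
  refine ⟨rfl, fun t _ => ?_⟩
  induction t with
  | zero => simp [tcState, TCState.init, IsSubforest]
  | succ t ih =>
    have ih' := ih (by omega)
    simp only [tcState, tcStep]
    split_ifs with h
    · have hX := h.choose_spec.1
      simp only [applyChangeset]
      split_ifs with hp hk
      · exact ⟨hp.2.2, hk⟩
      · simp [TCState.init, IsSubforest]
      · have hn := hX.resolve_left hp
        exact ⟨hn.2.2, (Finset.card_le_card Finset.sdiff_subset).trans ih'.2⟩
    · exact ih'

end TreeCaching

/-!
The proof compares TC with an optimal offline solution by potential functions. Let `C` and `c` be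
the cache and the counters of TC and let `D` be the offline cache. After each round, every valid
changeset is unsaturated (`tcStep_spec`), so an applied changeset has exactly `α` requests per node
on average.

* TC pays at most four times its number of paid positive requests (`tcCost_le`), since each fetched
  node has used up `α` of them, and each evicted node was fetched before. It remains to bound the
  positive requests that TC pays for and the offline solution does not.
* Such a request has a node `w ∈ D` with `w ∉ C`. Then `T(w) ⊆ D`, and the counter of `w` is at most
  `α * |T(w) \ C|`, because `T(w) \ C` is a valid changeset. The potential `room` of `w` pays for
  these requests. It grows only when TC evicts a node of `T(w) ∩ D` or when the offline solution
  evicts a node of `T(w)`. A node lies in `T(w)` for at most `height T` nodes `w`, and this is where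
  the height enters (`IsPhase.sum_room_le`).
* When TC evicts a changeset `X`, the nodes of `X ∩ D` carry at least `α` negative requests each on
  average, because the rest of `X` is itself a valid changeset. The offline solution has paid for
  these requests, except at nodes that it fetched later. The invariant `CoversEvictions` turns this
  into a bound on the evictions of nodes of `D` by the offline cost (`IsPhase.commonEvicted_le`).
* Hence in one phase the number of requests that only TC pays for is at most `height T` times
  `α * kOPT` plus twice the offline cost of the phase. In a finished phase TC has fetched, up to
  later evictions, at least `kONL + 1` nodes, counting the fetch that did not fit. Outside of the
  set of nodes that the offline solution ever caches in the phase, the `α` positive requests per node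
  are paid by the offline solution as well. So the offline cost of a finished phase is at least
  `α * (kONL + 1 - kOPT)` (`IsPhase.capacity_le_intervalCost`), which absorbs the term `α * kOPT`.
  For the last phase this term goes into the additive constant.
-/

set_option linter.unusedSectionVars false

namespace TreeCaching

variable {T : RootedTree.{u}} [DecidableEq T]

/-! ### Subforests -/

theorem IsSubforest.union {C D : Finset T} (hC : IsSubforest C) (hD : IsSubforest D) :
    IsSubforest (C ∪ D) := by
  intro v hv w hw
  rcases Finset.mem_union.1 hv with h | h
  · exact Finset.mem_union_left _ (hC v h w hw)
  · exact Finset.mem_union_right _ (hD v h w hw)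

theorem IsSubforest.inter {C D : Finset T} (hC : IsSubforest C) (hD : IsSubforest D) :
    IsSubforest (C ∩ D) := by
  intro v hv w hw
  rw [Finset.mem_inter] at hv ⊢
  exact ⟨hC v hv.1 w hw, hD v hv.2 w hw⟩

open Classical in
/-- The set `T(w)` of `w` and all its descendants. -/
noncomputable def desc [Fintype T] (w : T) : Finset T := Finset.univ.filter (w ≤ ·)

@[simp]
theorem mem_desc [Fintype T] {w v : T} : v ∈ desc w ↔ w ≤ v := by simp [desc]

theorem isSubforest_desc [Fintype T] (w : T) : IsSubforest (desc w) := by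
  intro v hv u hu
  rw [mem_desc] at hv ⊢
  exact hv.trans hu

theorem IsSubforest.desc_subset [Fintype T] {C : Finset T} (hC : IsSubforest C) {w : T}
    (hw : w ∈ C) : desc w ⊆ C := fun v hv => hC w hw v (mem_desc.1 hv)

/-- Every node lies in `T(w)` for at most `height T` nodes `w`. -/
theorem sum_card_desc_inter_le [Fintype T] (A Z : Finset T) :
    ∑ w ∈ A, (desc w ∩ Z).card ≤ height T * Z.card := by
  classical
  have h1 : ∀ w : T, (desc w ∩ Z).card = ∑ v ∈ Z, if w ≤ v then 1 else 0 := by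
    intro w
    rw [← Finset.card_filter]
    congr 1
    ext v
    simp [and_comm]
  simp_rw [h1]
  rw [Finset.sum_comm, mul_comm, ← smul_eq_mul]
  refine Finset.sum_le_card_nsmul _ _ _ fun v _ => ?_
  rw [← Finset.card_filter]
  refine le_trans ?_ (Finset.le_sup (f := fun v : T => (Set.Iic v).ncard) (Finset.mem_univ v))
  rw [← Set.ncard_coe_finset]
  refine Set.ncard_le_ncard ?_ (Set.toFinite _)
  intro w hw
  simp at hw
  exact hw.2

/-! ### Counters of valid changesets -/

/-- No valid changeset for `C` has more than `α` requests per node on average. -/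
def CountersLE (α : ℕ) (C : Finset T) (c : T → ℕ) : Prop :=
  ∀ X, IsChangeset C X → ∑ v ∈ X, c v ≤ X.card * α

/-- No valid changeset for `C` is saturated. -/
def CountersLT (α : ℕ) (C : Finset T) (c : T → ℕ) : Prop :=
  ∀ X, IsChangeset C X → ∑ v ∈ X, c v < X.card * α

/-- The counters `c` after a reset of the nodes of `X`. -/
def resetCounters (c : T → ℕ) (X : Finset T) : T → ℕ := fun v => if v ∈ X then 0 else c v

theorem sum_resetCounters (c : T → ℕ) (X Z : Finset T) :
    ∑ v ∈ Z, resetCounters c X v = ∑ v ∈ Z \ X, c v := by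
  unfold resetCounters
  rw [← Finset.sum_sdiff (Finset.sdiff_subset : Z \ X ⊆ Z)]
  have h1 : ∑ v ∈ Z \ (Z \ X), (if v ∈ X then 0 else c v) = 0 :=
    Finset.sum_eq_zero fun v hv => by
      have : v ∈ X := by grind
      simp [this]
  have h2 : ∑ v ∈ Z \ X, (if v ∈ X then 0 else c v) = ∑ v ∈ Z \ X, c v :=
    Finset.sum_congr rfl fun v hv => by
      have : v ∉ X := by grind
      simp [this]
  rw [h1, h2, zero_add]

theorem sum_countRequest (s : TCState T) (r : Request T) (X : Finset T) :
    ∑ v ∈ X, countRequest s r v =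
      ∑ v ∈ X, s.cnt v + if r.node ∈ X then serveCost s.cache r else 0 := by
  have h : ∀ v, countRequest s r v = s.cnt v + if v = r.node then serveCost s.cache r else 0 := by
    intro v
    unfold countRequest
    split_ifs <;> simp
  simp_rw [h, Finset.sum_add_distrib, Finset.sum_ite_eq']

theorem serveCost_le_one (C : Finset T) (r : Request T) : serveCost C r ≤ 1 := by
  unfold serveCost
  split_ifs <;> omega

theorem CountersLT.countRequest {α : ℕ} {s : TCState T} (h : CountersLT α s.cache s.cnt)
    (r : Request T) : CountersLE α s.cache (countRequest s r) := by
  intro X hX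
  have h1 := h X hX
  have h2 := serveCost_le_one s.cache r
  rw [sum_countRequest]
  split_ifs <;> omega

/-- One round of TC that does not end a phase, as a change from cache `C` and counters `c` (taken
after the request is served) to the next state. -/
inductive Transition (α : ℕ) (C : Finset T) (c : T → ℕ) : TCState T → Prop
  | stay : Transition α C c ⟨C, c⟩
  | fetch (X : Finset T) : IsPosChangeset C X → ∑ v ∈ X, c v = X.card * α →
      Transition α C c ⟨C ∪ X, resetCounters c X⟩
  | evict (X : Finset T) : IsNegChangeset C X → ∑ v ∈ X, c v = X.card * α →
      Transition α C c ⟨C \ X, resetCounters c X⟩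

/-- TC ends a phase: it would have to fetch a saturated changeset that does not fit. -/
def EndsPhase (α k : ℕ) (C : Finset T) (c : T → ℕ) (s' : TCState T) : Prop :=
  s' = TCState.init ∧
    ∃ X, IsPosChangeset C X ∧ ∑ v ∈ X, c v = X.card * α ∧ k < (C ∪ X).card

/-- The part of a positive changeset inside a subforest `D` is a positive changeset, if nonempty. -/
theorem IsPosChangeset.sum_inter_le {α : ℕ} {C X D : Finset T} {c : T → ℕ}
    (hX : IsPosChangeset C X) (hc : CountersLE α C c) (hC : IsSubforest C) (hD : IsSubforest D) :
    ∑ v ∈ X ∩ D, c v ≤ (X ∩ D).card * α := by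
  rcases (X ∩ D).eq_empty_or_nonempty with h | h
  · simp [h]
  · refine hc _ (Or.inl ⟨h, hX.2.1.mono_left Finset.inter_subset_left, ?_⟩)
    have := hX.2.2.inter (hC.union hD)
    convert this using 1
    grind

/-- The part of a negative changeset outside a subforest `D` is a negative changeset, if
nonempty. -/
theorem IsNegChangeset.sum_sdiff_le {α : ℕ} {C X D : Finset T} {c : T → ℕ}
    (hX : IsNegChangeset C X) (hc : CountersLE α C c) (hC : IsSubforest C) (hD : IsSubforest D) :
    ∑ v ∈ X \ D, c v ≤ (X \ D).card * α := by
  rcases (X \ D).eq_empty_or_nonempty with h | h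
  · simp [h]
  · refine hc _ (Or.inr ⟨h, Finset.sdiff_subset.trans hX.2.1, ?_⟩)
    have := hX.2.2.union (hC.inter hD)
    convert this using 1
    have := hX.2.1
    grind

theorem CountersLE.sum_cache_le {α : ℕ} {C : Finset T} {c : T → ℕ} (hc : CountersLE α C c) :
    ∑ v ∈ C, c v ≤ C.card * α := by
  rcases C.eq_empty_or_nonempty with h | h
  · simp [h]
  · exact hc _ (Or.inr ⟨h, subset_rfl, by simp [IsSubforest]⟩)

theorem CountersLT.init {α : ℕ} (hα : 1 ≤ α) :
    CountersLT α (TCState.init : TCState T).cache (TCState.init : TCState T).cnt := by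
  intro X hX
  have h1 : X.Nonempty := hX.elim And.left And.left
  have := h1.card_pos
  simp only [TCState.init, Finset.sum_const_zero]
  positivity

/-- If some valid changeset is saturated, then one of largest size is applicable. -/
theorem exists_isApplicable [Fintype T] {α : ℕ} {C X : Finset T} {c : T → ℕ}
    (hX : IsChangeset C X) (hs : X.card * α ≤ ∑ v ∈ X, c v) : ∃ X, IsApplicable α C c X := by
  classical
  obtain ⟨Y, hY, hmax⟩ := Finset.exists_max_image
    (Finset.univ.filter fun Y : Finset T => IsChangeset C Y ∧ Y.card * α ≤ ∑ v ∈ Y, c v)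
    Finset.card ⟨X, by simp [hX, hs]⟩
  simp only [Finset.mem_filter, Finset.mem_univ, true_and] at hY hmax
  refine ⟨Y, hY.1, hY.2, fun Z hZ hYZ => ?_⟩
  by_contra! hcon
  have := hmax Z ⟨hZ, hcon⟩
  have := Finset.card_lt_card hYZ
  omega

/-- One round of TC is a transition or ends the phase, and it leaves no changeset saturated. -/
theorem tcStep_spec [Fintype T] {α k : ℕ} (hα : 1 ≤ α) {s : TCState T} (r : Request T)
    (hC : IsSubforest s.cache) (h : CountersLT α s.cache s.cnt) :
    (Transition α s.cache (countRequest s r) (tcStep α k s r) ∨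
      EndsPhase α k s.cache (countRequest s r) (tcStep α k s r)) ∧
    CountersLT α (tcStep α k s r).cache (tcStep α k s r).cnt := by
  have hle := h.countRequest r
  unfold tcStep
  split_ifs with hex
  · obtain ⟨hX, hsat, hmax⟩ := hex.choose_spec
    generalize hex.choose = X at *
    have hsum := le_antisymm (hle X hX) hsat
    -- the request just served raised the counter of a node of `X`
    have hr : r.node ∈ X := by
      by_contra hr
      have h1 := h X hX
      rw [sum_countRequest, if_neg hr] at hsat
      omega
    -- hence a changeset disjoint from `X` still has its old counters
    have hdisj : ∀ Z, Disjoint Z X → IsChangeset s.cache Z →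
        ∑ v ∈ Z, countRequest s r v < Z.card * α := by
      intro Z hZX hZ
      rw [sum_countRequest, if_neg (Finset.disjoint_right.1 hZX hr)]
      exact h Z hZ
    have hgt : ∀ Z, Z.Nonempty → Disjoint Z X → IsChangeset s.cache (X ∪ Z) →
        ∑ v ∈ Z, countRequest s r v < Z.card * α := by
      intro Z hne hZX hZ
      have h1 := hmax _ hZ (by
        refine Finset.ssubset_iff_subset_ne.2 ⟨Finset.subset_union_left, fun he => ?_⟩
        obtain ⟨z, hz⟩ := hne
        exact Finset.disjoint_left.1 hZX hz (he ▸ Finset.mem_union_right _ hz))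
      rw [Finset.sum_union hZX.symm, Finset.card_union_of_disjoint hZX.symm, add_mul] at h1
      omega
    have hsplit : ∀ Z, Z.Nonempty → ((Z \ X).Nonempty → IsChangeset s.cache (Z \ X)) →
        ∑ v ∈ Z, resetCounters (countRequest s r) X v < Z.card * α := by
      intro Z hne hZ
      rw [sum_resetCounters]
      rcases (Z \ X).eq_empty_or_nonempty with h0 | h0
      · rw [h0, Finset.sum_empty]
        have := hne.card_pos
        positivity
      · exact (hdisj _ Finset.sdiff_disjoint (hZ h0)).trans_le
          (Nat.mul_le_mul_right _ (Finset.card_le_card Finset.sdiff_subset))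
    unfold applyChangeset
    split_ifs with hpos hk
    · refine ⟨Or.inl (.fetch X hpos hsum), ?_⟩
      have hXC : ∀ v, v ∈ X → v ∉ s.cache := fun v hv => Finset.disjoint_left.1 hpos.2.1 hv
      rintro Z (⟨hne, hZC, hZ⟩ | ⟨hne, hZC, hZ⟩)
      · have hZX : Disjoint Z X := hZC.mono_right Finset.subset_union_right
        change ∑ v ∈ Z, resetCounters (countRequest s r) X v < _
        rw [sum_resetCounters, Finset.sdiff_eq_self_of_disjoint hZX]
        refine hgt Z hne hZX (Or.inl ⟨hpos.1.mono Finset.subset_union_left, ?_, ?_⟩)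
        · exact Finset.disjoint_union_left.2
            ⟨hpos.2.1, hZC.mono_right Finset.subset_union_left⟩
        · rw [← Finset.union_assoc]
          exact hZ
      · refine hsplit Z hne fun hne' => Or.inr ⟨hne', ?_, ?_⟩
        · intro v hv
          rw [Finset.mem_sdiff] at hv
          exact (Finset.mem_union.1 (hZC hv.1)).resolve_right hv.2
        · convert hC.inter hZ using 1
          ext v
          have := hXC v
          simp only [Finset.mem_sdiff, Finset.mem_inter, Finset.mem_union]
          tauto
    · exact ⟨Or.inr ⟨rfl, X, hpos, hsum, not_le.1 hk⟩, CountersLT.init hα⟩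
    · have hneg := hX.resolve_left hpos
      have hXC : ∀ v, v ∈ X → v ∈ s.cache := fun v hv => hneg.2.1 hv
      refine ⟨Or.inl (.evict X hneg hsum), ?_⟩
      rintro Z (⟨hne, hZC, hZ⟩ | ⟨hne, hZC, hZ⟩)
      · refine hsplit Z hne fun hne' => Or.inl ⟨hne', ?_, ?_⟩
        · rw [Finset.disjoint_left] at hZC ⊢
          intro v hv hvC
          rw [Finset.mem_sdiff] at hv
          exact hZC hv.1 (Finset.mem_sdiff.2 ⟨hvC, hv.2⟩)
        · convert hC.union hZ using 1
          ext v
          have := hXC v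
          simp only [Finset.mem_sdiff, Finset.mem_union]
          tauto
      · change Z ⊆ s.cache \ X at hZC
        have hZX : Disjoint Z X := Finset.sdiff_disjoint.mono_left hZC
        change ∑ v ∈ Z, resetCounters (countRequest s r) X v < _
        rw [sum_resetCounters, Finset.sdiff_eq_self_of_disjoint hZX]
        refine hgt Z hne hZX (Or.inr ⟨hneg.1.mono Finset.subset_union_left, ?_, ?_⟩)
        · exact Finset.union_subset hneg.2.1 (hZC.trans Finset.sdiff_subset)
        · rw [Finset.sdiff_union_distrib, ← Finset.sdiff_sdiff_left']
          exact hZ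
  · refine ⟨Or.inl .stay, fun X hX => ?_⟩
    by_contra! hcon
    exact hex (exists_isApplicable hX hcon)

theorem tcState_cache_isSubforest (α k : ℕ) (I : ℕ → Request T) (t : ℕ) :
    IsSubforest (tcState α k I t).cache := ((tc_isFeasible α k I t).2 t le_rfl).1

theorem tcState_countersLT [Fintype T] {α : ℕ} (hα : 1 ≤ α) (k : ℕ) (I : ℕ → Request T) (t : ℕ) :
    CountersLT α (tcState α k I t).cache (tcState α k I t).cnt := by
  induction t with
  | zero => exact CountersLT.init hα
  | succ t ih => exact (tcStep_spec hα _ (tcState_cache_isSubforest α k I t) ih).2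

theorem Transition.isSubforest {α : ℕ} {C : Finset T} {c : T → ℕ} {s' : TCState T}
    (h : Transition α C c s') (hC : IsSubforest C) : IsSubforest s'.cache := by
  cases h with
  | stay => exact hC
  | fetch X hX _ => exact hX.2.2
  | evict X hX _ => exact hX.2.2

/-! ### The cost of TC and its positive requests -/

/-- The cost of a positive request `r` with cache `C`; negative requests count zero. -/
def posCost (C : Finset T) (r : Request T) : ℕ :=
  if r.positive = true ∧ r.node ∉ C then 1 else 0

theorem moveCost_empty (α : ℕ) (C : Finset T) : moveCost α C ∅ = α * C.card := by
  rw [moveCost, symmDiff_def]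
  simp

theorem Transition.moveCost_add_le [Fintype T] {α : ℕ} {C : Finset T} {c : T → ℕ}
    {s' : TCState T} (h : Transition α C c s') :
    moveCost α C s'.cache + 3 * ∑ v ∈ s'.cacheᶜ, s'.cnt v + 2 * (α * s'.cache.card) +
        ∑ v ∈ C, c v ≤
      3 * ∑ v ∈ Cᶜ, c v + 2 * (α * C.card) + ∑ v ∈ s'.cache, s'.cnt v := by
  cases h with
  | stay => simp [moveCost]
  | fetch X hX hs =>
    have hd := hX.2.1
    have e1 : symmDiff C (C ∪ X) = X := by
      ext v
      have := fun h : v ∈ X => Finset.disjoint_left.1 hd h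
      simp only [Finset.mem_symmDiff, Finset.mem_union]
      tauto
    have e2 : Cᶜ = X ∪ (C ∪ X)ᶜ := by
      ext v
      have := fun h : v ∈ X => Finset.disjoint_left.1 hd h
      simp only [Finset.mem_compl, Finset.mem_union]
      tauto
    have e3 : Disjoint X (C ∪ X)ᶜ :=
      (disjoint_compl_right (a := C ∪ X)).mono_left Finset.subset_union_right
    have e4 : (C ∪ X) \ X = C := by
      rw [Finset.union_sdiff_right, Finset.sdiff_eq_self_of_disjoint hd.symm]
    simp only [moveCost]
    rw [e1, sum_resetCounters, sum_resetCounters, Finset.sdiff_eq_self_of_disjoint e3.symm, e4, e2,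
      Finset.sum_union e3, hs, Finset.card_union_of_disjoint hd.symm, mul_add, mul_comm X.card]
    omega
  | evict X hX hs =>
    have hd := hX.2.1
    have e1 : symmDiff C (C \ X) = X := by
      ext v
      have := @hd v
      simp only [Finset.mem_symmDiff, Finset.mem_sdiff]
      tauto
    have e2 : (C \ X)ᶜ \ X = Cᶜ := by
      ext v
      have := @hd v
      simp only [Finset.mem_compl, Finset.mem_sdiff]
      tauto
    have e3 : (C \ X) \ X = C \ X := by simp
    have e4 := Finset.sum_sdiff (f := c) hd
    have e5 := Finset.card_sdiff_add_card_eq_card hd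
    simp only [moveCost]
    rw [e1, sum_resetCounters, sum_resetCounters, e2, e3, ← e4, ← e5, hs, mul_add,
      mul_comm X.card]
    omega

theorem serveCost_add_countRequest_le [Fintype T] (s : TCState T) (r : Request T) :
    serveCost s.cache r + 3 * ∑ v ∈ s.cacheᶜ, countRequest s r v + ∑ v ∈ s.cache, s.cnt v ≤
      4 * posCost s.cache r + 3 * ∑ v ∈ s.cacheᶜ, s.cnt v +
        ∑ v ∈ s.cache, countRequest s r v := by
  rw [sum_countRequest, sum_countRequest]
  simp only [Finset.mem_compl, posCost, serveCost]
  by_cases h1 : r.node ∈ s.cache <;> by_cases h2 : r.positive = true <;> simp [h1, h2] <;> omega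

/-- TC pays at most four times its cost of positive requests: each positive request pays for itself,
for a unit of the cost of the fetch that resets its counter and, in advance, for a unit of the
negative requests to the fetched nodes and a unit of the cost of their eviction. -/
theorem tcCost_le [Fintype T] {α : ℕ} (hα : 1 ≤ α) (k : ℕ) (I : ℕ → Request T) (n : ℕ) :
    tcCost α k I n ≤ 4 * ∑ t ∈ Finset.range n, posCost (tcState α k I t).cache (I t) := by
  -- the potential: an uncached node has prepaid three units per counted request, a cached node its
  -- eviction and `α` negative requests less those already counted
  have key : tcCost α k I n + 3 * ∑ v ∈ (tcState α k I n).cacheᶜ, (tcState α k I n).cnt v +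
      2 * (α * (tcState α k I n).cache.card) ≤
      4 * ∑ t ∈ Finset.range n, posCost (tcState α k I t).cache (I t) +
        ∑ v ∈ (tcState α k I n).cache, (tcState α k I n).cnt v := by
    induction n with
    | zero => simp [tcCost, cost, tcState, TCState.init]
    | succ n ih =>
      have hlt := tcState_countersLT hα k I n
      have h1 := serveCost_add_countRequest_le (tcState α k I n) (I n)
      have e : tcCost α k I (n + 1) = tcCost α k I n +
          (serveCost (tcState α k I n).cache (I n) +
            moveCost α (tcState α k I n).cache (tcState α k I (n + 1)).cache) :=
        Finset.sum_range_succ _ _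
      rw [e, Finset.sum_range_succ, mul_add]
      rcases (tcStep_spec (k := k) hα (I n) (tcState_cache_isSubforest α k I n) hlt).1 with h | h
      · have h2 := h.moveCost_add_le
        change moveCost α _ (tcState α k I (n + 1)).cache +
          3 * ∑ v ∈ (tcState α k I (n + 1)).cacheᶜ, (tcState α k I (n + 1)).cnt v +
          2 * (α * (tcState α k I (n + 1)).cache.card) + _ ≤ _ + _ +
          ∑ v ∈ (tcState α k I (n + 1)).cache, (tcState α k I (n + 1)).cnt v at h2
        omega
      · have h2 : tcState α k I (n + 1) = TCState.init := h.1
        have h3 := (hlt.countRequest (I n)).sum_cache_le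
        rw [h2]
        simp only [TCState.init, moveCost_empty, Finset.sum_const_zero, Finset.card_empty]
        rw [mul_comm] at h3
        omega
  have h3 : ∑ v ∈ (tcState α k I n).cache, (tcState α k I n).cnt v ≤
      (tcState α k I n).cache.card * α :=
    CountersLE.sum_cache_le fun X hX => (tcState_countersLT hα k I n X hX).le
  rw [mul_comm] at h3
  omega

/-! ### Requests that only TC pays for -/

/-- A positive request for which TC pays with cache `C`, but the offline solution with cache `D`
does not. -/
def unpaid (C D : Finset T) (r : Request T) : ℕ :=
  if r.positive = true ∧ r.node ∉ C ∧ r.node ∈ D then 1 else 0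

theorem posCost_le_unpaid_add (C D : Finset T) (r : Request T) :
    posCost C r ≤ unpaid C D r + serveCost D r := by
  simp only [posCost, unpaid, serveCost]
  by_cases h1 : r.node ∈ D <;> by_cases h2 : r.positive = true <;> by_cases h3 : r.node ∈ C <;>
    simp [h1, h2, h3]

/-- The potential of `w`, which pays for the requests to `w` that only TC pays for. If `w ∈ D`, then
`T(w) ⊆ D`, and only the second term remains: the number of requests that the counter of `w` can
still take before `T(w) \ C` is saturated. If `w ∉ D`, this term, truncated at zero, may have been
used up while `w` was cached offline; the first term keeps the potential from growing when the offline
solution fetches nodes. -/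
noncomputable def room [Fintype T] (α : ℕ) (C : Finset T) (c : T → ℕ) (D : Finset T) (w : T) : ℕ :=
  α * (desc w \ D).card + (α * ((desc w ∩ D) \ C).card - c w)

theorem room_countRequest [Fintype T] {α : ℕ} {s : TCState T} {D : Finset T} (r : Request T) (w : T)
    (hC : IsSubforest s.cache) (hc : CountersLE α s.cache (countRequest s r))
    (hD : IsSubforest D) :
    room α s.cache (countRequest s r) D w + (if w = r.node then unpaid s.cache D r else 0) ≤
      room α s.cache s.cnt D w := by
  have hmono : s.cnt w ≤ countRequest s r w := by
    unfold countRequest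
    split_ifs <;> omega
  unfold room
  by_cases h : w = r.node ∧ unpaid s.cache D r ≠ 0
  · obtain ⟨rfl, h⟩ := h
    have h0 : r.positive = true ∧ r.node ∉ s.cache ∧ r.node ∈ D := by
      by_contra hcon
      exact h (if_neg hcon)
    have h1 : unpaid s.cache D r = 1 := if_pos h0
    obtain ⟨hp, hnC, hnD⟩ := h0
    have h2 : countRequest s r r.node = s.cnt r.node + 1 := by
      simp [countRequest, serveCost, hp, hnC]
    have h3 : desc r.node ∩ D = desc r.node := Finset.inter_eq_left.2 (hD.desc_subset hnD)
    have hmem : r.node ∈ desc r.node \ s.cache := by simp [hnC]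
    -- all of `T(w)` outside of the cache is a valid changeset, which bounds the counter of `w`
    have h4 := hc (desc r.node \ s.cache) (Or.inl ⟨⟨_, hmem⟩, Finset.sdiff_disjoint, by
      rw [Finset.union_sdiff_self_eq_union]
      exact hC.union (isSubforest_desc _)⟩)
    have h5 := Finset.single_le_sum (f := countRequest s r) (fun _ _ => Nat.zero_le _) hmem
    rw [mul_comm] at h4
    rw [if_pos rfl, h1, h3]
    omega
  · have : (if w = r.node then unpaid s.cache D r else 0) = 0 := by
      split_ifs with hw
      · by_contra h'
        exact h ⟨hw, h'⟩
      · rfl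
    omega

theorem Transition.room_le [Fintype T] {α : ℕ} {C : Finset T} {c : T → ℕ} {s' : TCState T}
    (h : Transition α C c s') (hC : IsSubforest C) (D : Finset T) (w : T) :
    room α s'.cache s'.cnt D w ≤ room α C c D w + α * (desc w ∩ (D ∩ (C \ s'.cache))).card := by
  have hC' := h.isSubforest hC
  unfold room
  have hcard : ((desc w ∩ D) \ s'.cache).card ≤
      ((desc w ∩ D) \ C).card + (desc w ∩ (D ∩ (C \ s'.cache))).card := by
    refine (Finset.card_le_card ?_).trans (Finset.card_union_le _ _)
    intro v
    simp only [Finset.mem_union, Finset.mem_sdiff, Finset.mem_inter]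
    tauto
  -- a node that is fetched or evicted has all its descendants in one of the two caches
  have hcard' : w ∈ C ∪ s'.cache →
      ((desc w ∩ D) \ s'.cache).card ≤ (desc w ∩ (D ∩ (C \ s'.cache))).card := by
    intro hw
    refine Finset.card_le_card ?_
    intro v hv
    have hv' := (hC.union hC').desc_subset hw (x := v)
    simp only [Finset.mem_union, Finset.mem_sdiff, Finset.mem_inter] at *
    tauto
  have hα := Nat.mul_le_mul_left α hcard
  rw [mul_add] at hα
  have hcnt : s'.cnt w = c w ∨ w ∈ C ∪ s'.cache := by
    cases h with
    | stay => exact Or.inl rfl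
    | fetch X hX _ =>
      by_cases hw : w ∈ X
      · right; simp [hw]
      · left; simp [resetCounters, hw]
    | evict X hX _ =>
      by_cases hw : w ∈ X
      · right; simp [hX.2.1 hw]
      · left; simp [resetCounters, hw]
  rcases hcnt with hw | hw
  · rw [hw]
    omega
  · have := Nat.mul_le_mul_left α (hcard' hw)
    omega

/-- Fetching by the offline solution moves potential from the first term of `room` to the second. -/
theorem room_offline_le [Fintype T] (α : ℕ) (C : Finset T) (c : T → ℕ) (D D' : Finset T) (w : T) :
    room α C c D' w ≤ room α C c D w + α * (desc w ∩ (D \ D')).card := by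
  unfold room
  have h : (desc w \ D').card + ((desc w ∩ D') \ C).card ≤
      (desc w \ D).card + ((desc w ∩ D) \ C).card + (desc w ∩ (D \ D')).card := by
    have e1 : (desc w \ D').card = (desc w \ (D ∪ D')).card + (desc w ∩ (D \ D')).card := by
      rw [← Finset.card_union_of_disjoint]
      · congr 1
        ext v
        simp only [Finset.mem_union, Finset.mem_sdiff, Finset.mem_inter]
        tauto
      · rw [Finset.disjoint_left]
        intro v
        simp only [Finset.mem_union, Finset.mem_sdiff, Finset.mem_inter]
        tauto
    have e2 : (desc w \ D).card = (desc w \ (D ∪ D')).card + (desc w ∩ (D' \ D)).card := by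
      rw [← Finset.card_union_of_disjoint]
      · congr 1
        ext v
        simp only [Finset.mem_union, Finset.mem_sdiff, Finset.mem_inter]
        tauto
      · rw [Finset.disjoint_left]
        intro v
        simp only [Finset.mem_union, Finset.mem_sdiff, Finset.mem_inter]
        tauto
    have e3 : ((desc w ∩ D') \ C).card ≤ ((desc w ∩ D) \ C).card + (desc w ∩ (D' \ D)).card := by
      refine (Finset.card_le_card ?_).trans (Finset.card_union_le _ _)
      intro v
      simp only [Finset.mem_union, Finset.mem_sdiff, Finset.mem_inter]
      tauto
    omega
  have h1 : (desc w \ D').card ≤ (desc w \ D).card + (desc w ∩ (D \ D')).card := by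
    refine (Finset.card_le_card ?_).trans (Finset.card_union_le _ _)
    intro v
    simp only [Finset.mem_union, Finset.mem_sdiff, Finset.mem_inter]
    tauto
  have h' := Nat.mul_le_mul_left α h
  have h1' := Nat.mul_le_mul_left α h1
  simp only [mul_add] at h' h1'
  omega

theorem sum_countRequest_le_add_serveCost {s : TCState T} {D Z : Finset T} (r : Request T)
    (h : r.node ∈ Z → (r.node ∈ s.cache ↔ r.node ∈ D)) :
    ∑ v ∈ Z, countRequest s r v ≤ ∑ v ∈ Z, s.cnt v + serveCost D r := by
  rw [sum_countRequest]
  split_ifs with hz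
  · have : serveCost s.cache r = serveCost D r := by
      simp only [serveCost, h hz]
    omega
  · omega

/-! ### Evictions of nodes that the offline solution has cached -/

/-- The offline cost `O` accounts for `E` evictions by TC of nodes in the offline cache `D`, and
it covers the current negative counters up to a correction: there is a subforest `B` of `C ∩ D`
on which the counters are covered, and each further node of `C ∩ D` is covered with `α`. -/
def CoversEvictions (α : ℕ) (C : Finset T) (c : T → ℕ) (D : Finset T) (E O : ℕ) : Prop :=
  ∃ B : Finset T, IsSubforest B ∧ B ⊆ C ∩ D ∧
    α * E + ∑ v ∈ B, c v + α * ((C ∩ D) \ B).card ≤ O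

theorem CoversEvictions.countRequest {α : ℕ} {s : TCState T} {D : Finset T} {E O : ℕ}
    (h : CoversEvictions α s.cache s.cnt D E O) (r : Request T) :
    CoversEvictions α s.cache (countRequest s r) D E (O + serveCost D r) := by
  obtain ⟨B, hB, hBCD, hle⟩ := h
  have := sum_countRequest_le_add_serveCost (s := s) (D := D) (Z := B) r fun hr => by
    have := Finset.mem_inter.1 (hBCD hr)
    tauto
  exact ⟨B, hB, hBCD, by omega⟩

theorem CoversEvictions.offline {α : ℕ} {C : Finset T} {c : T → ℕ} {D D' : Finset T} {E O : ℕ}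
    (h : CoversEvictions α C c D E O) (hD' : IsSubforest D') :
    CoversEvictions α C c D' E (O + α * (D' \ D).card) := by
  obtain ⟨B, hB, hBCD, hle⟩ := h
  refine ⟨B ∩ D', hB.inter hD', ?_, ?_⟩
  · exact Finset.inter_subset_inter (hBCD.trans Finset.inter_subset_left) subset_rfl
  · have h1 : ∑ v ∈ B ∩ D', c v ≤ ∑ v ∈ B, c v :=
      Finset.sum_le_sum_of_subset Finset.inter_subset_left
    have h2 : ((C ∩ D') \ (B ∩ D')).card ≤ ((C ∩ D) \ B).card + (D' \ D).card := by
      refine (Finset.card_le_card ?_).trans (Finset.card_union_le _ _)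
      intro v
      simp only [Finset.mem_union, Finset.mem_sdiff, Finset.mem_inter]
      tauto
    have h3 := Nat.mul_le_mul_left α h2
    rw [mul_add] at h3
    omega

open Classical in
theorem CoversEvictions.fetch [Fintype T] {α : ℕ} {C X : Finset T} {c : T → ℕ} {D : Finset T}
    {E O : ℕ} (h : CoversEvictions α C c D E O) (hC : IsSubforest C) (hc : CountersLE α C c)
    (hX : IsPosChangeset C X) (hD : IsSubforest D) :
    CoversEvictions α (C ∪ X) (resetCounters c X) D E O := by
  obtain ⟨B, hB, hBCD, hle⟩ := h
  have hXC : ∀ v, v ∈ X → v ∉ C := fun v hv => Finset.disjoint_left.1 hX.2.1 hv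
  have hBC : ∀ v, v ∈ B → v ∈ C := fun v hv => (Finset.mem_inter.1 (hBCD hv)).1
  have hBD : ∀ v, v ∈ B → v ∈ D := fun v hv => (Finset.mem_inter.1 (hBCD hv)).2
  -- the new nodes of `D` join the covered set together with all their descendants
  obtain ⟨U, hU⟩ : ∃ U : Finset T, ∀ v, v ∈ U ↔ ∃ x ∈ X ∩ D, x ≤ v :=
    ⟨Finset.univ.filter fun v => ∃ x ∈ X ∩ D, x ≤ v, by simp⟩
  have hUsub : IsSubforest U := by
    intro v hv w hw
    rw [hU] at hv ⊢
    obtain ⟨x, hx, hxv⟩ := hv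
    exact ⟨x, hx, hxv.trans hw⟩
  have hUD : ∀ v, v ∈ U → v ∈ D := by
    intro v hv
    obtain ⟨x, hx, hxv⟩ := (hU v).1 hv
    exact hD x (Finset.mem_inter.1 hx).2 v hxv
  have hUCX : ∀ v, v ∈ U → v ∈ C ∪ X := by
    intro v hv
    obtain ⟨x, hx, hxv⟩ := (hU v).1 hv
    exact hX.2.2 x (Finset.mem_union_right _ (Finset.mem_inter.1 hx).1) v hxv
  have hXU : ∀ v, v ∈ X → v ∈ D → v ∈ U := fun v hv hv' =>
    (hU v).2 ⟨v, Finset.mem_inter.2 ⟨hv, hv'⟩, le_rfl⟩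
  -- `X` lies above whole trees of `C`: in a tree, two ancestors of a node are comparable
  have hCU : IsSubforest (C \ U) := by
    intro v hv w hw
    rw [Finset.mem_sdiff] at hv ⊢
    refine ⟨hC v hv.1 w hw, fun hwU => ?_⟩
    obtain ⟨x, hx, hxw⟩ := (hU w).1 hwU
    rcases le_total_of_directed hxw hw with hvx | hxv
    · exact hXC x (Finset.mem_inter.1 hx).1 (hC v hv.1 x hvx)
    · exact hv.2 ((hU v).2 ⟨x, hx, hxv⟩)
  -- so the old nodes that become covered form a negative changeset, which bounds their counters
  have hZ : ∑ v ∈ (C ∩ U) \ B, c v ≤ ((C ∩ U) \ B).card * α := by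
    rcases ((C ∩ U) \ B).eq_empty_or_nonempty with h0 | h0
    · simp [h0]
    · refine hc _ (Or.inr ⟨h0, Finset.sdiff_subset.trans Finset.inter_subset_left, ?_⟩)
      convert hCU.union hB using 1
      ext v
      have := hBC v
      simp only [Finset.mem_union, Finset.mem_sdiff, Finset.mem_inter]
      tauto
  refine ⟨B ∪ U, hB.union hUsub, ?_, ?_⟩
  · intro v hv
    rw [Finset.mem_inter]
    rcases Finset.mem_union.1 hv with hv | hv
    · exact ⟨Finset.mem_union_left _ (hBC v hv), hBD v hv⟩
    · exact ⟨hUCX v hv, hUD v hv⟩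
  · have e1 : (B ∪ U) \ X = B ∪ ((C ∩ U) \ B) := by
      ext v
      have h1 := hBC v
      have h2 := hXC v
      have h3 := hUCX v
      simp only [Finset.mem_union, Finset.mem_sdiff, Finset.mem_inter] at *
      tauto
    have e2 : ((C ∩ D) \ B) = (((C ∪ X) ∩ D) \ (B ∪ U)) ∪ ((C ∩ U) \ B) := by
      ext v
      have h1 := hXU v
      have h2 := hUD v
      simp only [Finset.mem_union, Finset.mem_sdiff, Finset.mem_inter] at *
      tauto
    have e3 : Disjoint (((C ∪ X) ∩ D) \ (B ∪ U)) ((C ∩ U) \ B) := by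
      rw [Finset.disjoint_left]
      intro v
      simp only [Finset.mem_union, Finset.mem_sdiff, Finset.mem_inter]
      tauto
    rw [sum_resetCounters, e1, Finset.sum_union Finset.disjoint_sdiff]
    rw [e2, Finset.card_union_of_disjoint e3, mul_add] at hle
    rw [mul_comm] at hZ
    omega

theorem CoversEvictions.evict {α : ℕ} {C X : Finset T} {c : T → ℕ} {D : Finset T}
    {E O : ℕ} (h : CoversEvictions α C c D E O) (hC : IsSubforest C) (hc : CountersLE α C c)
    (hX : IsNegChangeset C X) (hs : ∑ v ∈ X, c v = X.card * α) :
    CoversEvictions α (C \ X) (resetCounters c X) D (E + (X ∩ D).card) O := by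
  obtain ⟨B, hB, hBCD, hle⟩ := h
  have hXC : ∀ v, v ∈ X → v ∈ C := fun v hv => hX.2.1 hv
  have hBC : ∀ v, v ∈ B → v ∈ C := fun v hv => (Finset.mem_inter.1 (hBCD hv)).1
  have hBD : ∀ v, v ∈ B → v ∈ D := fun v hv => (Finset.mem_inter.1 (hBCD hv)).2
  refine ⟨B \ X, ?_, ?_, ?_⟩
  · convert hB.inter hX.2.2 using 1
    ext v
    have := hBC v
    simp only [Finset.mem_sdiff, Finset.mem_inter]
    tauto
  · intro v hv
    rw [Finset.mem_sdiff] at hv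
    rw [Finset.mem_inter, Finset.mem_sdiff]
    exact ⟨⟨hBC v hv.1, hv.2⟩, hBD v hv.1⟩
  · have e1 := Finset.sum_inter_add_sum_sdiff X B c
    -- `X \ B` has at most `α` requests per node, so `X ∩ B` has at least `α` per node
    have hXB := hX.sum_sdiff_le hc hC hB
    have e2 := Finset.card_inter_add_card_sdiff X B
    have e3 := Finset.sum_inter_add_sum_sdiff B X c
    have e4 : (X ∩ D).card = (X ∩ B).card + ((X ∩ D) \ B).card := by
      rw [← Finset.card_union_of_disjoint]
      · congr 1
        ext v
        have := hBD v
        simp only [Finset.mem_union, Finset.mem_sdiff, Finset.mem_inter]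
        tauto
      · rw [Finset.disjoint_left]
        intro v
        simp only [Finset.mem_sdiff, Finset.mem_inter]
        tauto
    have e5 : ((C ∩ D) \ B).card = (((C \ X) ∩ D) \ (B \ X)).card + ((X ∩ D) \ B).card := by
      rw [← Finset.card_union_of_disjoint]
      · congr 1
        ext v
        have := hXC v
        simp only [Finset.mem_union, Finset.mem_sdiff, Finset.mem_inter]
        tauto
      · rw [Finset.disjoint_left]
        intro v
        simp only [Finset.mem_sdiff, Finset.mem_inter]
        tauto
    rw [sum_resetCounters, sdiff_idem, e4]
    rw [e5] at hle
    rw [Finset.inter_comm B X] at e3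
    rw [← e2, add_mul] at hs
    simp only [mul_comm α, add_mul] at hle ⊢
    omega

theorem CoversEvictions.transition [Fintype T] {α : ℕ} {C : Finset T} {c : T → ℕ} {D : Finset T}
    {E O : ℕ} {s' : TCState T} (h : CoversEvictions α C c D E O) (hC : IsSubforest C)
    (hc : CountersLE α C c) (hD : IsSubforest D) (ht : Transition α C c s') :
    CoversEvictions α s'.cache s'.cnt D (E + (D ∩ (C \ s'.cache)).card) O := by
  cases ht with
  | stay => simpa using h
  | fetch X hX _ =>
    have : C \ (C ∪ X) = ∅ := Finset.sdiff_eq_empty_iff_subset.2 Finset.subset_union_left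
    simpa [this] using h.fetch hC hc hX hD
  | evict X hX hs =>
    have : D ∩ (C \ (C \ X)) = X ∩ D := by
      rw [sdiff_sdiff_right_self, Finset.inf_eq_inter, Finset.inter_eq_right.2 hX.2.1,
        Finset.inter_comm]
    dsimp only
    rw [this]
    exact h.evict hC hc hX hs

/-! ### Nodes that the offline solution never caches -/

/-- The positive requests of the current phase outside of a set `A`: each node of `C \ A` took
`α` of them to be fetched, the others are still counted. -/
def outsideLoad [Fintype T] (α : ℕ) (A C : Finset T) (c : T → ℕ) : ℕ :=
  α * (C \ A).card + ∑ v ∈ (C ∪ A)ᶜ, c v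

theorem outsideLoad_countRequest_le [Fintype T] (α : ℕ) {A D : Finset T} (hDA : D ⊆ A)
    (s : TCState T) (r : Request T) :
    outsideLoad α A s.cache (countRequest s r) ≤
      outsideLoad α A s.cache s.cnt + serveCost D r := by
  have := sum_countRequest_le_add_serveCost (s := s) (D := D) (Z := (s.cache ∪ A)ᶜ) r fun hr => by
    have := @hDA r.node
    simp only [Finset.mem_compl, Finset.mem_union] at hr
    tauto
  unfold outsideLoad
  omega

theorem IsPosChangeset.outsideLoad_le [Fintype T] {α : ℕ} {A C X : Finset T} {c : T → ℕ}
    (hX : IsPosChangeset C X) (hs : ∑ v ∈ X, c v = X.card * α) (hC : IsSubforest C)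
    (hc : CountersLE α C c) (hA : IsSubforest A) :
    outsideLoad α A (C ∪ X) (resetCounters c X) ≤ outsideLoad α A C c := by
  have hXC : ∀ v, v ∈ X → v ∉ C := fun v hv => Finset.disjoint_left.1 hX.2.1 hv
  -- `X ∩ A` has at most `α` requests per node, so `X \ A` has at least `α` per node
  have h1 := hX.sum_inter_le hc hC hA
  have e1 := Finset.sum_inter_add_sum_sdiff X A c
  have e2 := Finset.card_inter_add_card_sdiff X A
  have e3 : (C ∪ A)ᶜ = (C ∪ X ∪ A)ᶜ \ X ∪ X \ A := by
    ext v
    have := hXC v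
    simp only [Finset.mem_compl, Finset.mem_union, Finset.mem_sdiff]
    tauto
  have e4 : Disjoint ((C ∪ X ∪ A)ᶜ \ X) (X \ A) :=
    Finset.sdiff_disjoint.mono_right Finset.sdiff_subset
  have e5 : ((C ∪ X) \ A).card ≤ (C \ A).card + (X \ A).card := by
    rw [Finset.union_sdiff_distrib]
    exact Finset.card_union_le _ _
  have e6 := Nat.mul_le_mul_left α e5
  unfold outsideLoad
  rw [sum_resetCounters, e3, Finset.sum_union e4]
  rw [← e2, add_mul] at hs
  simp only [mul_comm α, add_mul] at e6 ⊢
  omega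

theorem Transition.outsideLoad_le [Fintype T] {α : ℕ} {A C : Finset T} {c : T → ℕ} {s' : TCState T}
    (h : Transition α C c s') (hC : IsSubforest C) (hc : CountersLE α C c) (hA : IsSubforest A) :
    outsideLoad α A s'.cache s'.cnt ≤ outsideLoad α A C c := by
  cases h with
  | stay => exact le_rfl
  | fetch X hX hs => exact hX.outsideLoad_le hs hC hc hA
  | evict X hX _ =>
    unfold outsideLoad
    rw [sum_resetCounters]
    have h1 : ((C \ X) \ A).card ≤ (C \ A).card :=
      Finset.card_le_card (Finset.sdiff_subset_sdiff Finset.sdiff_subset subset_rfl)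
    have h2 : ∑ v ∈ (C \ X ∪ A)ᶜ \ X, c v ≤ ∑ v ∈ (C ∪ A)ᶜ, c v := by
      refine Finset.sum_le_sum_of_subset ?_
      intro v
      simp only [Finset.mem_compl, Finset.mem_union, Finset.mem_sdiff]
      tauto
    have := Nat.mul_le_mul_left α h1
    dsimp only
    omega

/-! ### One phase of TC -/

/-- A phase of TC starts at time `a` and is still running at time `t`. -/
structure IsPhase (α k : ℕ) (I : ℕ → Request T) (a t : ℕ) : Prop where
  le : a ≤ t
  start : tcState α k I a = TCState.init
  step : ∀ u, a ≤ u → u < t → Transition α (tcState α k I u).cache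
    (countRequest (tcState α k I u) (I u)) (tcState α k I (u + 1))

theorem IsPhase.refl {α k : ℕ} {I : ℕ → Request T} {a : ℕ} (h : tcState α k I a = TCState.init) :
    IsPhase α k I a a :=
  ⟨le_rfl, h, fun u h1 h2 => by omega⟩

theorem IsPhase.succ {α k : ℕ} {I : ℕ → Request T} {a t : ℕ} (h : IsPhase α k I a t)
    (ht : Transition α (tcState α k I t).cache (countRequest (tcState α k I t) (I t))
      (tcState α k I (t + 1))) : IsPhase α k I a (t + 1) := by
  refine ⟨by have := h.le; omega, h.start, fun u h1 h2 => ?_⟩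
  rcases Nat.lt_succ_iff_lt_or_eq.1 h2 with h3 | rfl
  · exact h.step u h1 h3
  · exact ht

/-- Induction along a phase. -/
theorem IsPhase.induction {α k : ℕ} {I : ℕ → Request T} {a t : ℕ} (h : IsPhase α k I a t)
    (p : ℕ → Prop) (base : p a)
    (step : ∀ u, a ≤ u → u < t → Transition α (tcState α k I u).cache
      (countRequest (tcState α k I u) (I u)) (tcState α k I (u + 1)) → p u → p (u + 1)) :
    p t := by
  have : ∀ u, a ≤ u → u ≤ t → p u := by
    intro u hu
    induction u, hu using Nat.le_induction with
    | base => exact fun _ => base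
    | succ u hu ih => exact fun hut => step u hu hut (h.step u hu hut) (ih (by omega))
  exact this t h.le le_rfl

/-- The number of nodes that the cache sequence `S` fetches in the rounds `a, …, t - 1`. -/
def fetched (S : ℕ → Finset T) (a t : ℕ) : ℕ := ∑ u ∈ Finset.Ico a t, (S (u + 1) \ S u).card

/-- The number of nodes that the cache sequence `S` evicts in the rounds `a, …, t - 1`. -/
def evicted (S : ℕ → Finset T) (a t : ℕ) : ℕ := ∑ u ∈ Finset.Ico a t, (S u \ S (u + 1)).card

/-- The number of evictions, in the rounds `a, …, t - 1`, from the cache sequence `R` of nodes that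
are at that moment in the cache of `S`. -/
def commonEvicted (R S : ℕ → Finset T) (a t : ℕ) : ℕ :=
  ∑ u ∈ Finset.Ico a t, (S u ∩ (R u \ R (u + 1))).card

/-- The cost of serving the requests of the rounds `a, …, t - 1`. -/
def totalServe (I : ℕ → Request T) (S : ℕ → Finset T) (a t : ℕ) : ℕ :=
  ∑ u ∈ Finset.Ico a t, serveCost (S u) (I u)

/-- The total cost of the rounds `a, …, t - 1`. -/
def intervalCost (α : ℕ) (I : ℕ → Request T) (S : ℕ → Finset T) (a t : ℕ) : ℕ :=
  ∑ u ∈ Finset.Ico a t, (serveCost (S u) (I u) + moveCost α (S u) (S (u + 1)))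

/-- The number of positive requests in the rounds `a, …, t - 1` for which `R` pays and `S` does
not. -/
def totalUnpaid (I : ℕ → Request T) (R S : ℕ → Finset T) (a t : ℕ) : ℕ :=
  ∑ u ∈ Finset.Ico a t, unpaid (R u) (S u) (I u)

theorem moveCost_eq (α : ℕ) (C D : Finset T) :
    moveCost α C D = α * (C \ D).card + α * (D \ C).card := by
  rw [moveCost, symmDiff_def, Finset.sup_eq_union, Finset.card_union_of_disjoint, mul_add]
  exact Finset.sdiff_disjoint.mono_right Finset.sdiff_subset

theorem intervalCost_eq (α : ℕ) (I : ℕ → Request T) (S : ℕ → Finset T) (a t : ℕ) :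
    intervalCost α I S a t = totalServe I S a t + α * evicted S a t + α * fetched S a t := by
  simp only [intervalCost, totalServe, evicted, fetched, moveCost_eq, Finset.sum_add_distrib,
    Finset.mul_sum]
  omega

/-- All nodes that `S` caches at some time from `a` to `t`. -/
def everCached (S : ℕ → Finset T) (a t : ℕ) : Finset T := (Finset.Icc a t).biUnion S

theorem subset_everCached {S : ℕ → Finset T} {a t u : ℕ} (h1 : a ≤ u) (h2 : u ≤ t) :
    S u ⊆ everCached S a t :=
  Finset.subset_biUnion_of_mem S (Finset.mem_Icc.2 ⟨h1, h2⟩)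

theorem isSubforest_everCached {S : ℕ → Finset T} (hS : ∀ u, IsSubforest (S u)) (a t : ℕ) :
    IsSubforest (everCached S a t) := by
  intro v hv w hw
  rw [everCached, Finset.mem_biUnion] at hv ⊢
  obtain ⟨u, hu, hv⟩ := hv
  exact ⟨u, hu, hS u v hv w hw⟩

theorem card_everCached_le (S : ℕ → Finset T) {a t : ℕ} (h : a ≤ t) :
    (everCached S a t).card ≤ (S a).card + fetched S a t := by
  induction t, h using Nat.le_induction with
  | base => simp [everCached, fetched]
  | succ t h ih =>
    have h1 : everCached S a (t + 1) ⊆ everCached S a t ∪ (S (t + 1) \ S t) := by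
      intro v hv
      rw [everCached, Finset.mem_biUnion] at hv
      obtain ⟨u, hu, hv⟩ := hv
      rw [Finset.mem_Icc] at hu
      rw [Finset.mem_union, Finset.mem_sdiff]
      rcases Nat.lt_succ_iff_lt_or_eq.1 (Nat.lt_succ_iff.2 hu.2) with h3 | rfl
      · exact Or.inl (subset_everCached hu.1 (by omega) hv)
      · by_cases hvt : v ∈ S t
        · exact Or.inl (subset_everCached h le_rfl hvt)
        · exact Or.inr ⟨hv, hvt⟩
    have h2 := (Finset.card_le_card h1).trans (Finset.card_union_le _ _)
    have h3 : fetched S a (t + 1) = fetched S a t + (S (t + 1) \ S t).card :=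
      Finset.sum_Ico_succ_top h _
    omega

theorem unpaid_add_sum_room_countRequest_le [Fintype T] {α : ℕ} {s : TCState T} {A D : Finset T}
    (r : Request T) (hC : IsSubforest s.cache) (hc : CountersLE α s.cache (countRequest s r))
    (hD : IsSubforest D) (hDA : D ⊆ A) :
    unpaid s.cache D r + ∑ w ∈ A, room α s.cache (countRequest s r) D w ≤
      ∑ w ∈ A, room α s.cache s.cnt D w := by
  have h1 := Finset.sum_le_sum fun w (_ : w ∈ A) => room_countRequest r w hC hc hD
  rw [Finset.sum_add_distrib, Finset.sum_ite_eq'] at h1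
  have h2 : unpaid s.cache D r ≤ if r.node ∈ A then unpaid s.cache D r else 0 := by
    split_ifs with h
    · exact le_rfl
    · rw [unpaid, if_neg]
      exact fun h' => h (hDA h'.2.2)
  omega

/-- During a phase, the potentials of the nodes of `A` pay for the requests that only TC pays for.
They start with at most `α` for each pair of a node of `A` and one of its ancestors, and they grow
when TC evicts a node that the offline solution has cached, or when the latter evicts a node. -/
theorem IsPhase.sum_room_le [Fintype T] {α k : ℕ} {I : ℕ → Request T} {a t : ℕ}
    (h : IsPhase α k I a t) (hα : 1 ≤ α) {S : ℕ → Finset T} (hS : ∀ u, IsSubforest (S u))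
    {A : Finset T} (hA : IsSubforest A) (hSA : ∀ u, a ≤ u → u ≤ t → S u ⊆ A) :
    ∑ w ∈ A, room α (tcState α k I t).cache (tcState α k I t).cnt (S t) w +
        totalUnpaid I (fun u => (tcState α k I u).cache) S a t ≤
      α * (height T * (A.card + commonEvicted (fun u => (tcState α k I u).cache) S a t +
        evicted S a t)) := by
  refine h.induction (fun t => ∑ w ∈ A, room α (tcState α k I t).cache (tcState α k I t).cnt (S t) w
    + totalUnpaid I (fun u => (tcState α k I u).cache) S a t ≤
      α * (height T * (A.card + commonEvicted (fun u => (tcState α k I u).cache) S a t +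
        evicted S a t))) ?_ ?_
  · simp only [totalUnpaid, commonEvicted, evicted, Finset.Ico_self, Finset.sum_empty, add_zero,
      h.start]
    refine le_trans (Eq.le ?_) (Nat.mul_le_mul_left α (sum_card_desc_inter_le A A))
    rw [Finset.mul_sum]
    refine Finset.sum_congr rfl fun w hw => ?_
    rw [Finset.inter_eq_left.2 (hA.desc_subset hw)]
    simp only [room, TCState.init, Finset.sdiff_empty, Nat.sub_zero]
    rw [← mul_add, add_comm, Finset.card_inter_add_card_sdiff]
  · intro u hau hut htr ih
    have hCu := tcState_cache_isSubforest α k I u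
    have h1 := unpaid_add_sum_room_countRequest_le (I u) hCu
      ((tcState_countersLT hα k I u).countRequest (I u)) (hS u) (hSA u hau hut.le)
    have h2 := Finset.sum_le_sum fun w (_ : w ∈ A) => htr.room_le hCu (S u) w
    have h3 := Finset.sum_le_sum fun w (_ : w ∈ A) =>
      room_offline_le α (tcState α k I (u + 1)).cache (tcState α k I (u + 1)).cnt
        (S u) (S (u + 1)) w
    rw [Finset.sum_add_distrib, ← Finset.mul_sum] at h2 h3
    have h4 := Nat.mul_le_mul_left α (sum_card_desc_inter_le A
      (S u ∩ ((tcState α k I u).cache \ (tcState α k I (u + 1)).cache)))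
    have h5 := Nat.mul_le_mul_left α (sum_card_desc_inter_le A (S u \ S (u + 1)))
    simp only [totalUnpaid, commonEvicted, evicted, Finset.sum_Ico_succ_top hau, mul_add] at ih ⊢
    omega

/-- During a phase, the offline cost covers the evictions of commonly cached nodes. -/
theorem IsPhase.commonEvicted_le [Fintype T] {α k : ℕ} {I : ℕ → Request T} {a t : ℕ}
    (h : IsPhase α k I a t) (hα : 1 ≤ α) {S : ℕ → Finset T} (hS : ∀ u, IsSubforest (S u)) :
    α * commonEvicted (fun u => (tcState α k I u).cache) S a t ≤
      totalServe I S a t + α * fetched S a t := by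
  have key : CoversEvictions α (tcState α k I t).cache (tcState α k I t).cnt (S t)
      (commonEvicted (fun u => (tcState α k I u).cache) S a t)
      (totalServe I S a t + α * fetched S a t) := by
    refine h.induction (fun t => CoversEvictions α
      (tcState α k I t).cache (tcState α k I t).cnt (S t)
      (commonEvicted (fun u => (tcState α k I u).cache) S a t)
      (totalServe I S a t + α * fetched S a t)) ?_ ?_
    · refine ⟨∅, by simp [IsSubforest], by simp, ?_⟩
      simp [h.start, TCState.init, commonEvicted]
    · intro u hau hut htr ih
      have hCu := tcState_cache_isSubforest α k I u
      have h1 := ((ih.countRequest (I u)).transition hCu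
        ((tcState_countersLT hα k I u).countRequest (I u)) (hS u) htr).offline (hS (u + 1))
      convert h1 using 1
      · simp only [commonEvicted, Finset.sum_Ico_succ_top hau]
      · simp only [totalServe, fetched, Finset.sum_Ico_succ_top hau, mul_add]
        omega
  obtain ⟨B, -, -, hle⟩ := key
  omega

theorem IsPhase.outsideLoad_le [Fintype T] {α k : ℕ} {I : ℕ → Request T} {a t : ℕ}
    (h : IsPhase α k I a t) (hα : 1 ≤ α) {S : ℕ → Finset T} {A : Finset T}
    (hA : IsSubforest A) (hSA : ∀ u, a ≤ u → u ≤ t → S u ⊆ A) :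
    outsideLoad α A (tcState α k I t).cache (tcState α k I t).cnt ≤ totalServe I S a t := by
  refine h.induction (fun t =>
    outsideLoad α A (tcState α k I t).cache (tcState α k I t).cnt ≤ totalServe I S a t) ?_ ?_
  · simp [outsideLoad, h.start, TCState.init]
  · intro u hau hut htr ih
    have h1 := outsideLoad_countRequest_le α (hSA u hau hut.le) (tcState α k I u) (I u)
    have h2 := htr.outsideLoad_le (tcState_cache_isSubforest α k I u)
      ((tcState_countersLT hα k I u).countRequest (I u)) hA
    simp only [totalServe, Finset.sum_Ico_succ_top hau] at ih ⊢
    omega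

/-- In a phase, the offline cost bounds the number of requests that only TC pays for. The potentials
are kept on the left-hand side, since they also bound the request served at time `t`. -/
theorem IsPhase.sum_room_add_totalUnpaid_le [Fintype T] {α k kOPT : ℕ} {I : ℕ → Request T}
    {a t : ℕ} (h : IsPhase α k I a t) (hα : 1 ≤ α) {S : ℕ → Finset T}
    (hS : ∀ u, IsSubforest (S u)) (hk : (S a).card ≤ kOPT) :
    ∑ w ∈ everCached S a t, room α (tcState α k I t).cache (tcState α k I t).cnt (S t) w +
        totalUnpaid I (fun u => (tcState α k I u).cache) S a t ≤
      height T * (α * kOPT + 2 * intervalCost α I S a t) := by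
  have h1 := h.sum_room_le hα hS (isSubforest_everCached hS a t)
    fun u h1 h2 => subset_everCached h1 h2
  have h2 := h.commonEvicted_le hα hS
  have h3 := Nat.mul_le_mul_left α ((card_everCached_le S h.le).trans
    (Nat.add_le_add_right hk _))
  refine h1.trans ?_
  rw [mul_left_comm]
  refine Nat.mul_le_mul_left _ ?_
  rw [intervalCost_eq]
  simp only [mul_add] at h3 ⊢
  omega

theorem IsPhase.totalUnpaid_le [Fintype T] {α k kOPT : ℕ} {I : ℕ → Request T}
    {a t : ℕ} (h : IsPhase α k I a t) (hα : 1 ≤ α) {S : ℕ → Finset T}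
    (hS : ∀ u, IsSubforest (S u)) (hk : (S a).card ≤ kOPT) :
    totalUnpaid I (fun u => (tcState α k I u).cache) S a t ≤
      height T * (α * kOPT + 2 * intervalCost α I S a t) :=
  le_of_add_le_right (h.sum_room_add_totalUnpaid_le hα hS hk)

theorem IsPhase.totalUnpaid_succ_le [Fintype T] {α k kOPT : ℕ} {I : ℕ → Request T}
    {a t : ℕ} (h : IsPhase α k I a t) (hα : 1 ≤ α) {S : ℕ → Finset T}
    (hS : ∀ u, IsSubforest (S u)) (hk : (S a).card ≤ kOPT) :
    totalUnpaid I (fun u => (tcState α k I u).cache) S a (t + 1) ≤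
      height T * (α * kOPT + 2 * intervalCost α I S a (t + 1)) := by
  have h1 := h.sum_room_add_totalUnpaid_le hα hS hk
  have h2 := unpaid_add_sum_room_countRequest_le (I t) (tcState_cache_isSubforest α k I t)
    ((tcState_countersLT hα k I t).countRequest (I t)) (hS t)
    (subset_everCached h.le le_rfl)
  have h3 : intervalCost α I S a t ≤ intervalCost α I S a (t + 1) := by
    rw [intervalCost, intervalCost, Finset.sum_Ico_succ_top h.le]
    omega
  have h4 : height T * (α * kOPT + 2 * intervalCost α I S a t) ≤
      height T * (α * kOPT + 2 * intervalCost α I S a (t + 1)) := by gcongr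
  simp only [totalUnpaid, Finset.sum_Ico_succ_top h.le] at h1 ⊢
  omega

/-- In a finished phase, TC would fetch more than `k` nodes, and the offline solution pays `α` for
each of them that exceeds its own capacity. -/
theorem IsPhase.capacity_le_intervalCost [Fintype T] {α k kOPT : ℕ} {I : ℕ → Request T}
    {a t : ℕ} (h : IsPhase α k I a t) (hα : 1 ≤ α) {S : ℕ → Finset T}
    (hS : ∀ u, IsSubforest (S u)) (hk : (S a).card ≤ kOPT)
    (hend : EndsPhase α k (tcState α k I t).cache (countRequest (tcState α k I t) (I t))
      (tcState α k I (t + 1))) :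
    α * (k + 1) ≤ α * kOPT + intervalCost α I S a (t + 1) := by
  obtain ⟨-, X, hX, hs, hkX⟩ := hend
  have hA := isSubforest_everCached hS a t
  have h1 := h.outsideLoad_le (S := S) hα hA fun u h1 h2 => subset_everCached h1 h2
  have h2 := outsideLoad_countRequest_le α (subset_everCached (S := S) h.le le_rfl)
    (tcState α k I t) (I t)
  have h3 := hX.outsideLoad_le hs (tcState_cache_isSubforest α k I t)
    ((tcState_countersLT hα k I t).countRequest (I t)) hA
  have h4 := Nat.mul_le_mul_left α ((card_everCached_le S h.le).trans
    (Nat.add_le_add_right hk _))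
  have h5 := Nat.mul_le_mul_left α
    (show k + 1 ≤ (((tcState α k I t).cache ∪ X) \ everCached S a t).card +
      (everCached S a t).card by
      have := Finset.le_card_sdiff (everCached S a t) ((tcState α k I t).cache ∪ X)
      omega)
  have h6 : α * (((tcState α k I t).cache ∪ X) \ everCached S a t).card ≤
      outsideLoad α (everCached S a t) ((tcState α k I t).cache ∪ X)
        (resetCounters (countRequest (tcState α k I t) (I t)) X) := Nat.le_add_right _ _
  rw [intervalCost_eq]
  simp only [totalServe, fetched, evicted, Finset.sum_Ico_succ_top h.le, mul_add] at *
  omega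

/-! ### All phases together -/

/-- At any time, the number of requests in the finished phases that only TC pays for is at most a
multiple of the offline cost of these phases. By at least `m` nodes, the fetch that ends a phase
exceeds the offline capacity. -/
theorem exists_isPhase_totalUnpaid_le [Fintype T] {α k kOPT m : ℕ} (hα : 1 ≤ α)
    (hm : k + 1 = kOPT + m) (I : ℕ → Request T) {S : ℕ → Finset T}
    (hS : ∀ u, IsSubforest (S u)) (hk : ∀ u, (S u).card ≤ kOPT) (n : ℕ) :
    ∃ a, IsPhase α k I a n ∧
      m * totalUnpaid I (fun u => (tcState α k I u).cache) S 0 a ≤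
        height T * ((kOPT + 2 * m) * intervalCost α I S 0 a) := by
  induction n with
  | zero => exact ⟨0, .refl rfl, by simp [totalUnpaid]⟩
  | succ n ih =>
    obtain ⟨a, hph, hle⟩ := ih
    rcases (tcStep_spec (k := k) hα (I n) (tcState_cache_isSubforest α k I n)
      (tcState_countersLT hα k I n)).1 with h | h
    · exact ⟨a, hph.succ h, hle⟩
    · refine ⟨n + 1, .refl h.1, ?_⟩
      have h1 := hph.totalUnpaid_succ_le hα hS (hk a)
      have h2 := hph.capacity_le_intervalCost hα hS (hk a) h
      have h3 : totalUnpaid I (fun u => (tcState α k I u).cache) S 0 (n + 1) =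
          totalUnpaid I (fun u => (tcState α k I u).cache) S 0 a +
            totalUnpaid I (fun u => (tcState α k I u).cache) S a (n + 1) :=
        (Finset.sum_Ico_consecutive _ (Nat.zero_le a) (hph.le.trans n.le_succ)).symm
      have h4 : intervalCost α I S 0 (n + 1) =
          intervalCost α I S 0 a + intervalCost α I S a (n + 1) :=
        (Finset.sum_Ico_consecutive _ (Nat.zero_le a) (hph.le.trans n.le_succ)).symm
      rw [hm, mul_add] at h2
      have h5 : α * m ≤ intervalCost α I S a (n + 1) := by omega
      have h6 := Nat.mul_le_mul_left m h1
      have h7 := Nat.mul_le_mul_left (height T * kOPT) h5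
      rw [h3, h4]
      nlinarith

theorem one_le_height (T : RootedTree.{u}) [Fintype T] : 1 ≤ height T := by
  refine le_trans ?_ (Finset.le_sup (f := fun v : T => (Set.Iic v).ncard) (Finset.mem_univ ⊥))
  simp

/-- An optimal solution, kept constant after the last round, so that all its caches are legal. -/
theorem exists_offline (α k : ℕ) (I : ℕ → Request T) (n : ℕ) :
    ∃ S : ℕ → Finset T, (∀ u, IsSubforest (S u)) ∧ (∀ u, (S u).card ≤ k) ∧
      intervalCost α I S 0 n = optCost α k I n := by
  obtain ⟨S, hS, hcost⟩ := exists_cost_eq_optCost α k I n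
  refine ⟨fun u => S (min u n), fun u => (hS.2 _ (min_le_right _ _)).1,
    fun u => (hS.2 _ (min_le_right _ _)).2, ?_⟩
  rw [← hcost, cost, intervalCost, Nat.Ico_zero_eq_range]
  refine Finset.sum_congr rfl fun u hu => ?_
  rw [Finset.mem_range] at hu
  rw [min_eq_left hu.le, min_eq_left (Nat.succ_le_of_lt hu)]

end TreeCaching

theorem mainTheorem1 :
    ∃ c : ℝ, 0 < c ∧
      ∀ (T : RootedTree.{u}) [Fintype T] [DecidableEq T] (α kONL kOPT : ℕ),
        1 ≤ α → 1 ≤ kONL → kOPT ≤ kONL →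
        ∀ (I : ℕ → TreeCaching.Request T) (n : ℕ),
          (TreeCaching.tcCost α kONL I n : ℝ) ≤
            c * ((TreeCaching.height T : ℝ) * ((kONL : ℝ) / ((kONL : ℝ) - (kOPT : ℝ) + 1))) *
                (TreeCaching.optCost α kOPT I n : ℝ) +
              c * ((TreeCaching.height T : ℝ) * (kONL : ℝ) * (α : ℝ)) := by
  open TreeCaching in
  refine ⟨28, by norm_num, ?_⟩
  intro T _ _ α K k hα hK hkK I n
  obtain ⟨m, hm⟩ : ∃ m, K + 1 = k + m := ⟨K + 1 - k, by omega⟩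
  obtain ⟨S, hS, hk, hopt⟩ := exists_offline α k I n
  obtain ⟨a, hph, hdone⟩ := exists_isPhase_totalUnpaid_le hα hm I hS hk n
  have hlast := hph.totalUnpaid_le hα hS (hk a)
  have hTC := tcCost_le hα K I n
  have hpos : ∑ t ∈ Finset.range n, posCost (tcState α K I t).cache (I t) ≤
      totalUnpaid I (fun u => (tcState α K I u).cache) S 0 n + intervalCost α I S 0 n := by
    rw [totalUnpaid, intervalCost, ← Finset.sum_add_distrib, Nat.Ico_zero_eq_range]
    refine Finset.sum_le_sum fun t _ => (posCost_le_unpaid_add _ (S t) _).trans ?_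
    omega
  have hU : totalUnpaid I (fun u => (tcState α K I u).cache) S 0 n =
      totalUnpaid I (fun u => (tcState α K I u).cache) S 0 a +
        totalUnpaid I (fun u => (tcState α K I u).cache) S a n :=
    (Finset.sum_Ico_consecutive _ (Nat.zero_le a) hph.le).symm
  have hO : intervalCost α I S 0 n = intervalCost α I S 0 a + intervalCost α I S a n :=
    (Finset.sum_Ico_consecutive _ (Nat.zero_le a) hph.le).symm
  rw [← hopt]
  have hh := one_le_height T
  generalize totalUnpaid I (fun u => (tcState α K I u).cache) S 0 n = U at *
  generalize totalUnpaid I (fun u => (tcState α K I u).cache) S 0 a = U₁ at *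
  generalize totalUnpaid I (fun u => (tcState α K I u).cache) S a n = U₂ at *
  generalize intervalCost α I S 0 n = O at *
  generalize intervalCost α I S 0 a = O₁ at *
  generalize intervalCost α I S a n = O₂ at *
  generalize height T = h at *
  generalize tcCost α K I n = C at *
  have hden : (K : ℝ) - k + 1 = m := by
    have : (K : ℝ) + 1 = k + m := by exact_mod_cast hm
    linarith
  have hm0 : (0 : ℝ) < m := by
    have : 0 < m := by omega
    exact_mod_cast this
  rw [hden]
  set ρ : ℝ := K / m with hρ
  have hρm : ρ * m = K := div_mul_cancel₀ _ hm0.ne'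
  have hρ1 : (1 : ℝ) ≤ 2 * ρ := by
    have : (m : ℝ) ≤ 2 * K := by
      have : m ≤ 2 * K := by omega
      exact_mod_cast this
    rw [hρ, ← mul_div_assoc, le_div_iff₀ hm0]
    linarith
  have hkK' : (k : ℝ) ≤ K := by exact_mod_cast hkK
  have hh' : (1 : ℝ) ≤ h := by exact_mod_cast hh
  have hU₁ : (U₁ : ℝ) ≤ h * ((ρ + 2) * O₁) := by
    have h1 : (m : ℝ) * U₁ ≤ h * ((k + 2 * m) * O₁) := by exact_mod_cast hdone
    have h2 : (h : ℝ) * ((k + 2 * m) * O₁) ≤ h * ((K + 2 * m) * O₁) := by gcongr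
    refine le_of_mul_le_mul_left ((h1.trans h2).trans_eq ?_) hm0
    rw [← hρm]
    ring
  have hU₂ : (U₂ : ℝ) ≤ h * (α * K + 2 * O₂) := by
    have h1 : (U₂ : ℝ) ≤ h * (α * k + 2 * O₂) := by exact_mod_cast hlast
    refine h1.trans ?_
    gcongr
  have hC : (C : ℝ) ≤ 4 * (U₁ + U₂ + O) := by
    have : C ≤ 4 * (U₁ + U₂ + O) := by omega
    exact_mod_cast this
  have hO' : (O : ℝ) = O₁ + O₂ := by exact_mod_cast hO
  have hρ0 : 0 ≤ ρ := by positivity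
  have e1 : (h : ℝ) * O ≤ 2 * (h * ρ * O) := by
    have := mul_le_mul_of_nonneg_right hρ1 (by positivity : (0 : ℝ) ≤ h * O)
    linarith
  have e2 : (O : ℝ) ≤ h * O := le_mul_of_one_le_left (by positivity) hh'
  have e3 : (h : ℝ) * ρ * O₁ ≤ h * ρ * O := by
    rw [hO']
    gcongr
    exact le_add_of_nonneg_right (by positivity)
  have e4 : (h : ℝ) * O = h * O₁ + h * O₂ := by rw [hO']; ring
  have e5 : (0 : ℝ) ≤ h * K * α := by positivity
  linarith
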